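/- Let $\xi(s)=\tfrac12 s(s-1)\pi^{-s/2}\Gamma(s/2)\zeta(s)$ be the Riemann xi function, extended to an entire function by removing singularities. Its zeros are the non-trivial zeros of $\zeta$ (those with $0<\operatorname{Re}\rho<1$), and every product over zeros below counts each zero with its multiplicity as a zero of $\xi$. Write a zero as $\rho=\tfrac12+\delta+i\beta$ with $\delta,\beta\in\mathbb R$. Let $\Omega_1$ be the set of zeros $\rho_m=\tfrac12+i\beta_m$ with $\beta_m>0$, and $\Omega_2$ the (possibly empty) set of zeros $\rho_k=\tfrac12+\delta_k+i\beta_k$ with $\delta_k>0$ and $\beta_k>0$. **Theorem 3.1.** For every $s\in\mathbb C$, the Hadamard product of $\xi$, with the zeros ordered by modulus, namely $$\xi(s)=\frac12\prod_{\rho}\Bigl(1-\frac s\rho\Bigr)=\lim_{T\to\infty}\frac12\prod_{|\rho|\le T}\Bigl(1-\frac s\rho\Bigr),$$ regroups as $$\xi(s)=\frac12\prod_{\rho_m\in\Omega_1}\left(1+\frac{s^2-s}{\frac14+\beta_m^2}\right)\prod_{\rho_k\in\Omega_2}\left(1+\frac{(s^2-s)^2+(s^2-s)\left(\frac12-2\delta_k^2+2\beta_k^2\right)}{\left(\frac14+\delta_k^2+\beta_k^2\right)^2-\delta_k^2}\right),$$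 where both products converge unconditionally, the factor of $\rho_m\in\Omega_1$ equals $\left(1-\frac{s}{\rho_m}\right)\left(1-\frac{s}{1-\rho_m}\right)$, and the factor of $\rho_k\in\Omega_2$ equals $\left(1-\frac{s}{\rho_k}\right)\left(1-\frac{s}{1-\rho_k}\right)\left(1-\frac{s}{\overline{\rho_k}}\right)\left(1-\frac{s}{1-\overline{\rho_k}}\right)$. (A product over an empty set is $1$.) -/

import Mathlib

open Filter Topology

noncomputable section

namespace RiemannXi

/-- The Riemann xi function `ξ(s) = (1/2) s (s - 1) π ^ (-s/2) Γ(s/2) ζ(s)`, as an entire function.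
With `Λ(s) = π ^ (-s/2) Γ(s/2) ζ(s) = Λ₀(s) - 1/s - 1/(1-s)` and `Λ₀` entire, this is
`(s (s - 1) Λ₀(s) + 1) / 2`; this form has the right values at the removable singularities of the
first formula, where it reads `0 * ∞`.  See `xi_eq` for the agreement elsewhere. -/
def xi (s : ℂ) : ℂ := (s * (s - 1) * completedRiemannZeta₀ s + 1) / 2

theorem xi_eq_completed {s : ℂ} (h0 : s ≠ 0) (h1 : s ≠ 1) :
    xi s = 1 / 2 * s * (s - 1) * completedRiemannZeta s := by
  have h1' : (1 : ℂ) - s ≠ 0 := sub_ne_zero.mpr (Ne.symm h1)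
  rw [completedRiemannZeta_eq, xi]
  field_simp
  ring

theorem completed_eq {s : ℂ} (h : ∀ n : ℕ, s ≠ -(2 * n)) :
    completedRiemannZeta s =
      (Real.pi : ℂ) ^ (-s / 2) * Complex.Gamma (s / 2) * riemannZeta s := by
  have h0 : s ≠ 0 := by simpa using h 0
  have hG : Complex.Gammaℝ s ≠ 0 := by
    rw [Ne, Complex.Gammaℝ_eq_zero_iff]
    rintro ⟨n, hn⟩
    exact h n hn
  rw [← Complex.Gammaℝ_def, riemannZeta_def_of_ne_zero h0, mul_div_cancel₀ _ hG]

/-- The defining formula of `ξ`, away from `s = 1` and the poles of `Γ(s/2)`. -/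
theorem xi_eq {s : ℂ} (h : ∀ n : ℕ, s ≠ -(2 * n)) (h1 : s ≠ 1) :
    xi s = 1 / 2 * s * (s - 1) * (Real.pi : ℂ) ^ (-s / 2) * Complex.Gamma (s / 2) *
      riemannZeta s := by
  have h0 : s ≠ 0 := by simpa using h 0
  rw [xi_eq_completed h0 h1, completed_eq h]
  ring

theorem xi_zero : xi 0 = 1 / 2 := by simp [xi]

theorem differentiable_xi : Differentiable ℂ xi := by
  have := differentiable_completedZeta₀
  unfold xi
  fun_prop

theorem xi_one_sub (s : ℂ) : xi (1 - s) = xi s := by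
  rw [xi, xi, completedRiemannZeta₀_one_sub]
  ring

/-- The non-trivial zeros of the Riemann zeta function. -/
def nontrivialZeros : Set ℂ := {ρ | riemannZeta ρ = 0 ∧ 0 < ρ.re ∧ ρ.re < 1}

/-- The zeros of `ξ` are exactly the non-trivial zeros of `ζ`. -/
theorem mem_nontrivialZeros_iff (s : ℂ) : s ∈ nontrivialZeros ↔ xi s = 0 := by
  have key : ∀ s : ℂ, 0 < s.re → s ≠ 1 → (xi s = 0 ↔ riemannZeta s = 0) := by
    intro s hs h1
    have h0 : s ≠ 0 := by rintro rfl; simp at hs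
    have hn : ∀ n : ℕ, s ≠ -(2 * n) := by
      rintro n rfl
      simp at hs
      have : (0 : ℝ) ≤ n := n.cast_nonneg
      linarith
    have hG : (Real.pi : ℂ) ^ (-s / 2) * Complex.Gamma (s / 2) ≠ 0 := by
      rw [← Complex.Gammaℝ_def]
      exact Complex.Gammaℝ_ne_zero_of_re_pos hs
    rw [xi_eq_completed h0 h1, completed_eq hn]
    simp only [mul_eq_zero, hG, sub_eq_zero, h0, h1] 
    norm_num
  have one_le : ∀ s : ℂ, 1 ≤ s.re → xi s ≠ 0 := by
    intro s hs
    by_cases h1 : s = 1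
    · subst h1
      simp [xi]
    · rw [Ne, key s (by linarith) h1]
      exact riemannZeta_ne_zero_of_one_le_re hs
  constructor
  · rintro ⟨hz, h0, h1⟩
    refine (key s h0 ?_).mpr hz
    rintro rfl
    simp at h1
  · intro hx
    have h1 : s.re < 1 := by
      by_contra h
      exact one_le s (not_lt.mp h) hx
    have h0 : 0 < s.re := by
      by_contra h
      refine one_le (1 - s) ?_ (by rw [xi_one_sub, hx])
      simp only [Complex.sub_re, Complex.one_re]
      linarith
    refine ⟨(key s h0 ?_).mp hx, h0, h1⟩
    rintro rfl
    simp at h1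

/-- The multiplicity of a zero `ρ` of `ξ`. -/
def mult (ρ : ℂ) : ℕ := analyticOrderNatAt xi ρ

theorem finite_zeros_norm_le (T : ℝ) : {ρ | ρ ∈ nontrivialZeros ∧ ‖ρ‖ ≤ T}.Finite := by
  refine ((isCompact_closedBall (0 : ℂ) T).inter_riemannZetaZeros_finite).subset ?_
  rintro ρ ⟨h, hT⟩
  exact ⟨by simpa using hT, h.1⟩

/-- The (finite) set of non-trivial zeros of modulus at most `T`. -/
def zerosUpTo (T : ℝ) : Finset ℂ := (finite_zeros_norm_le T).toFinset

/-- The zeros on the critical line and in the upper half-plane: `ρ = 1/2 + iβ`, `β > 0`. -/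
def onLine : Set ℂ := {ρ | ρ ∈ nontrivialZeros ∧ ρ.re = 1 / 2 ∧ 0 < ρ.im}

/-- The zeros to the right of the critical line and in the upper half-plane:
`ρ = 1/2 + δ + iβ`, `δ > 0`, `β > 0`. -/
def offLine : Set ℂ := {ρ | ρ ∈ nontrivialZeros ∧ 1 / 2 < ρ.re ∧ 0 < ρ.im}

/-- The imaginary part `β` of `ρ = 1/2 + δ + iβ`, as a complex number. -/
def beta (ρ : ℂ) : ℂ := (ρ.im : ℂ)

/-- The real number `δ` in `ρ = 1/2 + δ + iβ`, as a complex number. -/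
def delta (ρ : ℂ) : ℂ := ((ρ.re - 1 / 2 : ℝ) : ℂ)

/-- `1 + (s² - s) / (1/4 + β²)` -/
def onFactor (ρ s : ℂ) : ℂ := 1 + (s ^ 2 - s) / (1 / 4 + beta ρ ^ 2)

/-- `1 + ((s² - s)² + (s² - s) (1/2 - 2δ² + 2β²)) / ((1/4 + δ² + β²)² - δ²)` -/
def offFactor (ρ s : ℂ) : ℂ :=
  1 + ((s ^ 2 - s) ^ 2 + (s ^ 2 - s) * (1 / 2 - 2 * delta ρ ^ 2 + 2 * beta ρ ^ 2)) /
    ((1 / 4 + delta ρ ^ 2 + beta ρ ^ 2) ^ 2 - delta ρ ^ 2)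

end RiemannXi

end

/-! The function `z ↦ ξ(1/2 + z)` is even, and its logarithm grows like `R log R`, which is `o(R²)`.
Dividing out the zeros in `|z| ≤ R` leaves a non-vanishing function on the disc, with a logarithm
`g` such that `g(0) = g'(0) = 0`. Borel–Carathéodory and a second-order Schwarz lemma give `g(z) =
O(M / R²)` for fixed `z`, where `M` bounds the growth of the logarithm. Thus `g → 0`, and no
exponential factor survives (`tendsto_prod_one_sub_div_of_even`).

The growth bound comes from writing `Λ₀` as a Mellin transform of a nonnegative kernel, so that
vertical strips are controlled by real points. The same positivity excludes real zeros, so the zeros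
split into conjugate pairs. At `s = 3` every paired factor is at least `1 + 1/|ρ|²`. Convergence
there forces `∑ mult ρ / |ρ|² < ∞` (`summable_mult_div_norm_sq`), hence unconditional convergence of
the paired product for all `s`. Ordering by modulus and regrouping by `ρ ↦ 1 - conj ρ` are then
legitimate. -/

/-! ### Dividing zeros out of an entire function -/

theorem Differentiable.analyticOrderAt_ne_top {f : ℂ → ℂ} (hf : Differentiable ℂ f) {c : ℂ}
    (hc : f c ≠ 0) (w : ℂ) : analyticOrderAt f w ≠ ⊤ := fun h =>
  hc (congrFun ((AnalyticOnNhd.analyticOrderAt_eq_top_iff_eq_zero w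
    (fun z => hf.analyticAt z)).1 h) c)

theorem Differentiable.exists_eq_pow_mul {f : ℂ → ℂ} (hf : Differentiable ℂ f) {w : ℂ}
    (hw : analyticOrderAt f w ≠ ⊤) :
    ∃ g : ℂ → ℂ, Differentiable ℂ g ∧ g w ≠ 0 ∧
      ∀ z, f z = (z - w) ^ analyticOrderNatAt f w * g z := by
  obtain ⟨g₀, hg₀, hg₀w, hfg⟩ := ((hf.analyticAt w).analyticOrderNatAt_eq_iff hw).1 rfl
  set n := analyticOrderNatAt f w
  set g := Function.update (fun z => f z / (z - w) ^ n) w (g₀ w) with hg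
  have hgw : g w = g₀ w := by simp [hg]
  have hgz : ∀ z, z ≠ w → g z = f z / (z - w) ^ n := fun z hz => by simp [hg, hz]
  have hev : g =ᶠ[𝓝 w] g₀ := by
    filter_upwards [hfg] with z hz
    rcases eq_or_ne z w with rfl | hne
    · exact hgw
    · rw [hgz z hne, hz, smul_eq_mul, mul_div_cancel_left₀ _ (pow_ne_zero _ (sub_ne_zero.2 hne))]
  refine ⟨g, fun z => ?_, by rwa [hgw], fun z => ?_⟩
  · rcases eq_or_ne z w with rfl | hne
    · exact (hg₀.congr hev.symm).differentiableAt
    · have h1 : DifferentiableAt ℂ (fun z => f z / (z - w) ^ n) z :=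
        (hf z).div (by fun_prop) (pow_ne_zero _ (sub_ne_zero.2 hne))
      refine h1.congr_of_eventuallyEq ?_
      filter_upwards [isOpen_ne.mem_nhds hne] with y hy using hgz y hy
  · rcases eq_or_ne z w with rfl | hne
    · have := hfg.self_of_nhds
      rw [this, hgw, smul_eq_mul]
    · rw [hgz z hne, mul_div_cancel₀ _ (pow_ne_zero _ (sub_ne_zero.2 hne))]

theorem Differentiable.exists_eq_prod_mul {f : ℂ → ℂ} (hf : Differentiable ℂ f) {c : ℂ}
    (hc : f c ≠ 0) (Z : Finset ℂ) :
    ∃ g : ℂ → ℂ, Differentiable ℂ g ∧ (∀ a ∈ Z, g a ≠ 0) ∧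
      ∀ z, f z = (∏ a ∈ Z, (z - a) ^ analyticOrderNatAt f a) * g z := by
  classical
  induction Z using Finset.induction_on with
  | empty => exact ⟨f, hf, by simp, by simp⟩
  | insert b Z hb ih =>
    obtain ⟨g, hg, hgZ, hfg⟩ := ih
    have hgc : g c ≠ 0 := right_ne_zero_of_mul (hfg c ▸ hc)
    have hP : AnalyticAt ℂ (fun z => ∏ a ∈ Z, (z - a) ^ analyticOrderNatAt f a) b :=
      Differentiable.analyticAt (by fun_prop) b
    -- The factors already removed do not vanish at `b`, so the quotient keeps the order of `f`
    -- there.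
    have hord : analyticOrderNatAt f b = analyticOrderNatAt g b := by
      have h1 : f = (fun z => ∏ a ∈ Z, (z - a) ^ analyticOrderNatAt f a) * g := funext hfg
      have h2 : analyticOrderAt (fun z => ∏ a ∈ Z, (z - a) ^ analyticOrderNatAt f a) b = 0 := by
        rw [hP.analyticOrderAt_eq_zero, Finset.prod_ne_zero_iff]
        intro a ha
        exact pow_ne_zero _ (sub_ne_zero.2 (by rintro rfl; exact hb ha))
      have h3 := analyticOrderAt_mul hP (hg.analyticAt b)
      rw [← h1, h2, zero_add] at h3
      rw [analyticOrderNatAt, analyticOrderNatAt, h3]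
    obtain ⟨k, hk, hkb, hgk⟩ := hg.exists_eq_pow_mul (hg.analyticOrderAt_ne_top hgc b)
    refine ⟨k, hk, ?_, fun z => ?_⟩
    · intro a ha
      rcases Finset.mem_insert.1 ha with rfl | ha
      · exact hkb
      · exact right_ne_zero_of_mul (hgk a ▸ hgZ a ha)
    · rw [Finset.prod_insert hb, hfg z, hgk z, hord]
      ring

theorem Differentiable.exists_eq_prod_one_sub_div_mul {f : ℂ → ℂ} (hf : Differentiable ℂ f)
    {c : ℂ} (hc : f c ≠ 0) {Z : Finset ℂ} (hZ : ∀ a ∈ Z, a ≠ 0) :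
    ∃ g : ℂ → ℂ, Differentiable ℂ g ∧ (∀ a ∈ Z, g a ≠ 0) ∧
      ∀ z, f z = (∏ a ∈ Z, (1 - z / a) ^ analyticOrderNatAt f a) * g z := by
  obtain ⟨g, hg, hgZ, hfg⟩ := hf.exists_eq_prod_mul hc Z
  have hC : ∏ a ∈ Z, (-a) ^ analyticOrderNatAt f a ≠ 0 :=
    Finset.prod_ne_zero_iff.2 fun a ha => pow_ne_zero _ (neg_ne_zero.2 (hZ a ha))
  refine ⟨fun z => (∏ a ∈ Z, (-a) ^ analyticOrderNatAt f a) * g z, hg.const_mul _,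
    fun a ha => mul_ne_zero hC (hgZ a ha), fun z => ?_⟩
  rw [hfg z, ← mul_assoc, ← Finset.prod_mul_distrib]
  congr 1
  refine Finset.prod_congr rfl fun a ha => ?_
  rw [← mul_pow]
  congr 1
  field_simp [hZ a ha]
  ring

/-- A non-vanishing holomorphic function on a disc has a logarithm. -/
theorem exists_exp_eq_on_ball {h : ℂ → ℂ} {R : ℝ} (hR : 0 < R)
    (hh : DifferentiableOn ℂ h (Metric.ball 0 R)) (h0 : ∀ z ∈ Metric.ball (0 : ℂ) R, h z ≠ 0) :
    ∃ g : ℂ → ℂ, g 0 = 0 ∧ (∀ z ∈ Metric.ball (0 : ℂ) R, HasDerivAt g (deriv h z / h z) z) ∧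
      ∀ z ∈ Metric.ball (0 : ℂ) R, h z = h 0 * Complex.exp (g z) := by
  have hmem : (0 : ℂ) ∈ Metric.ball (0 : ℂ) R := Metric.mem_ball_self hR
  have hd : DifferentiableOn ℂ (fun z => deriv h z / h z) (Metric.ball 0 R) :=
    (DifferentiableOn.deriv hh Metric.isOpen_ball).div hh h0
  obtain ⟨G, hG⟩ := hd.isExactOn_ball
  refine ⟨fun z => G z - G 0, by simp, fun z hz => (hG z hz).sub_const _, fun z hz => ?_⟩
  -- `G` is a primitive of `h'/h`, so `h · exp(-(G - G 0))` has zero derivative and is constant on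
  -- the ball.
  have hconst : ∀ z ∈ Metric.ball (0 : ℂ) R,
      HasDerivAt (fun z => h z * Complex.exp (-(G z - G 0))) 0 z := by
    intro z hz
    have h1 : HasDerivAt h (deriv h z) z :=
      (hh.differentiableAt (Metric.isOpen_ball.mem_nhds hz)).hasDerivAt
    have h2 := h1.mul ((((hG z hz).sub_const (G 0)).neg).cexp)
    refine h2.congr_deriv ?_
    field_simp [h0 z hz]
    ring
  have h3 := (convex_ball (0 : ℂ) R).is_const_of_fderivWithin_eq_zero (𝕜 := ℂ)
    (f := fun z => h z * Complex.exp (-(G z - G 0)))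
    (fun z hz => (hconst z hz).differentiableAt.differentiableWithinAt)
    (fun z hz => by
      rw [fderivWithin_of_isOpen Metric.isOpen_ball hz]
      exact (hconst z hz).hasFDerivAt.fderiv.trans (by ext; simp)) hz hmem
  simp only [sub_self, neg_zero, Complex.exp_zero, mul_one] at h3
  rw [← h3, mul_assoc, ← Complex.exp_add]
  simp

/-! ### Hadamard products of even functions -/

theorem analyticOrderNatAt_neg_of_even {f : ℂ → ℂ} 
    (heven : ∀ z, f (-z) = f z) (a : ℂ) : analyticOrderNatAt f (-a) = analyticOrderNatAt f a := by
  have h := analyticOrderAt_comp_of_deriv_ne_zero (f := f) (g := fun z : ℂ => -z) (z₀ := a)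
    (by fun_prop) (by simp)
  have h2 : f ∘ (fun z : ℂ => -z) = f := funext heven
  rw [h2] at h
  rw [analyticOrderNatAt, analyticOrderNatAt, h]

/-- Evenness supplies the exponent 2: the logarithm of the zero-free quotient vanishes to second
order at `0`, so a bound `2M` on the half disc improves quadratically towards the centre. -/
theorem exists_exp_bound_of_even {f : ℂ → ℂ} (hf : Differentiable ℂ f)
    (heven : ∀ z, f (-z) = f z) (hf0 : f 0 ≠ 0) {R M : ℝ} (hR : 0 < R) (hM : 0 < M)
    {Z : Finset ℂ} (hZ : ∀ a, a ∈ Z ↔ f a = 0 ∧ ‖a‖ ≤ R)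
    (hbound : ∀ z, ‖z‖ = 2 * R → ‖f z‖ ≤ ‖f 0‖ * Real.exp M) {z : ℂ} (hz : ‖z‖ < R / 2) :
    ∃ g : ℂ, ‖g‖ ≤ 2 * M * (‖z‖ / (R / 2)) ^ 2 ∧
      f z = f 0 * Complex.exp g * ∏ a ∈ Z, (1 - z / a) ^ analyticOrderNatAt f a := by
  have hZ0 : ∀ a ∈ Z, a ≠ 0 := by
    rintro a ha rfl
    exact hf0 ((hZ 0).1 ha).1
  obtain ⟨h, hh, hhZ, hfh⟩ := hf.exists_eq_prod_one_sub_div_mul hf0 hZ0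
  set P : ℂ → ℂ := fun z => ∏ a ∈ Z, (1 - z / a) ^ analyticOrderNatAt f a with hP
  have hh0 : h 0 = f 0 := by rw [hfh 0]; simp
  have hPdiff : Differentiable ℂ P := by fun_prop
  have hPeven : ∀ z, P (-z) = P z := by
    intro z
    refine Finset.prod_nbij' (fun a => -a) (fun a => -a) ?_ ?_ (by simp) (by simp) ?_
    · intro a ha
      rw [hZ] at ha ⊢
      rwa [heven, norm_neg]
    · intro a ha
      rw [hZ] at ha ⊢
      rwa [heven, norm_neg]
    · intro a ha
      rw [analyticOrderNatAt_neg_of_even heven, neg_div, div_neg]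
  have hnz : ∀ z ∈ Metric.ball (0 : ℂ) R, h z ≠ 0 := by
    intro z hz h0
    have hfz : f z = 0 := by rw [hfh, h0, mul_zero]
    exact hhZ z ((hZ z).2 ⟨hfz, (mem_ball_zero_iff.1 hz).le⟩) h0
  have hmax : ∀ z ∈ Metric.ball (0 : ℂ) R, ‖h z‖ ≤ ‖f 0‖ * Real.exp M := by
    intro z hz
    refine Complex.norm_le_of_forall_mem_frontier_norm_le (U := Metric.ball 0 (2 * R))
      Metric.isBounded_ball hh.diffContOnCl (fun w hw => ?_)
      (subset_closure (Metric.ball_subset_ball (by linarith) hz))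
    rw [frontier_ball _ (by positivity), mem_sphere_zero_iff_norm] at hw
    -- On `|w| = 2R` each removed zero has `|w/a| ≥ 2`, so division by `P` does not increase the
    -- modulus; the maximum principle carries the bound inside.
    have hP1 : 1 ≤ ‖P w‖ := by
      rw [hP, norm_prod]
      refine Finset.one_le_prod fun a ha => ?_
      rw [norm_pow]
      refine one_le_pow₀ ?_
      have ha' := ((hZ a).1 ha).2
      have hapos : 0 < ‖a‖ := norm_pos_iff.2 (hZ0 a ha)
      have h2 : 2 ≤ ‖w / a‖ := by
        rw [norm_div, hw, le_div_iff₀ hapos]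
        linarith
      have := norm_sub_norm_le (w / a) 1
      rw [norm_one, norm_sub_rev] at this
      linarith
    calc ‖h w‖ ≤ ‖P w‖ * ‖h w‖ := le_mul_of_one_le_left (norm_nonneg _) hP1
      _ = ‖f w‖ := by rw [hfh w, norm_mul]
      _ ≤ _ := hbound w hw
  obtain ⟨g, hg0, hgd, hge⟩ := exists_exp_eq_on_ball hR hh.differentiableOn hnz
  have hmem : (0 : ℂ) ∈ Metric.ball (0 : ℂ) R := Metric.mem_ball_self hR
  have hderiv : deriv h 0 = 0 := by
    have hP0 : P 0 ≠ 0 := by simp [hP]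
    have hev : (fun z => h (-z)) =ᶠ[𝓝 0] h := by
      filter_upwards [hPdiff.continuous.continuousAt.eventually_ne hP0] with z hz
      have h1 := hfh (-z)
      have h2 : f z = P z * h z := hfh z
      change f (-z) = P (-z) * h (-z) at h1
      rw [heven, hPeven, h2] at h1
      exact (mul_left_cancel₀ hz h1).symm
    have := hev.deriv_eq
    rw [deriv_comp_neg, neg_zero] at this
    linear_combination (-1 / 2 : ℂ) * this
  have hg' : HasDerivAt g 0 0 := by simpa [hderiv] using hgd 0 hmem
  have hgre : Set.MapsTo g (Metric.ball 0 R) {w | w.re ≤ M} := by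
    intro z hz
    have h1 := hmax z hz
    rw [hge z hz, hh0, norm_mul, Complex.norm_exp] at h1
    exact Real.exp_le_exp.1 (le_of_mul_le_mul_left h1 (norm_pos_iff.2 hf0))
  have hgdiff : DifferentiableOn ℂ g (Metric.ball 0 R) := fun z hz =>
    (hgd z hz).differentiableAt.differentiableWithinAt
  have hsub : Metric.ball (0 : ℂ) (R / 2) ⊆ Metric.ball 0 R :=
    Metric.ball_subset_ball (by linarith)
  -- The Borel–Carathéodory bound `2M r / (R - r)` is at most `2M` when `r < R/2`.
  have hmaps : Set.MapsTo g (Metric.ball 0 (R / 2)) (Metric.closedBall (g 0) (2 * M)) := by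
    intro z hz
    have h1 := Complex.borelCaratheodory_zero hM hgdiff hgre hR (hsub hz) hg0
    rw [hg0, mem_closedBall_zero_iff]
    rw [mem_ball_zero_iff] at hz
    refine h1.trans ?_
    rw [div_le_iff₀ (by linarith)]
    nlinarith
  have hlittle : (fun w => g w - g 0) =o[𝓝 0] fun w : ℂ => ‖w - 0‖ ^ 1 := by
    have := hg'.isLittleO
    simpa using this.norm_right
  have hfin := Complex.dist_le_mul_div_pow_of_mapsTo_ball_of_isLittleO (hgdiff.mono hsub) hmaps
    hlittle (mem_ball_zero_iff.2 hz)
  rw [hg0, dist_zero_right, dist_zero_right] at hfin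
  refine ⟨g z, hfin, ?_⟩
  rw [hfh z, hge z (hsub (mem_ball_zero_iff.2 hz)), hh0]
  ring

/-- Hadamard's product for an even entire function whose logarithm grows slower than `R ^ 2`. -/
theorem tendsto_prod_one_sub_div_of_even {f : ℂ → ℂ} (hf : Differentiable ℂ f)
    (heven : ∀ z, f (-z) = f z) (hf0 : f 0 ≠ 0) {Z : ℕ → Finset ℂ}
    (hZ : ∀ n a, a ∈ Z n ↔ f a = 0 ∧ ‖a‖ ≤ n) {M : ℕ → ℝ} (hM0 : ∀ n, 0 < M n)
    (hM : Tendsto (fun n => M n / (n : ℝ) ^ 2) atTop (𝓝 0))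
    (hbound : ∀ᶠ n : ℕ in atTop, ∀ z, ‖z‖ = 2 * n → ‖f z‖ ≤ ‖f 0‖ * Real.exp (M n)) (z : ℂ) :
    Tendsto (fun n => ∏ a ∈ Z n, (1 - z / a) ^ analyticOrderNatAt f a) atTop
      (𝓝 (f z / f 0)) := by
  have key : ∀ᶠ n : ℕ in atTop, ∃ g : ℂ, ‖g‖ ≤ 2 * M n * (‖z‖ / (n / 2)) ^ 2 ∧
      f z = f 0 * Complex.exp g * ∏ a ∈ Z n, (1 - z / a) ^ analyticOrderNatAt f a := by
    obtain ⟨N, hN⟩ := exists_nat_gt (2 * ‖z‖)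
    filter_upwards [hbound, eventually_ge_atTop N, eventually_gt_atTop 0] with n hn hNn hpos
    have hNn' : (N : ℝ) ≤ n := Nat.cast_le.2 hNn
    exact exists_exp_bound_of_even hf heven hf0 (Nat.cast_pos.2 hpos) (hM0 n) (hZ n) hn
      (by linarith)
  obtain ⟨g, hg⟩ := Filter.skolem.1 key
  have hg0 : Tendsto g atTop (𝓝 0) := by
    have h1 : Tendsto (fun n => 8 * ‖z‖ ^ 2 * (M n / (n : ℝ) ^ 2)) atTop (𝓝 0) := by
      simpa using hM.const_mul (8 * ‖z‖ ^ 2)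
    refine squeeze_zero_norm' ?_ h1
    filter_upwards [hg] with n hn
    refine hn.1.trans (le_of_eq ?_)
    rw [div_div_eq_mul_div, div_pow]
    ring
  have h2 : Tendsto (fun n => f z / f 0 * Complex.exp (-g n)) atTop (𝓝 (f z / f 0)) := by
    have := ((Complex.continuous_exp.tendsto _).comp hg0.neg).const_mul (f z / f 0)
    simpa using this
  refine h2.congr' ?_
  filter_upwards [hg] with n hn
  rw [hn.2, Complex.exp_neg]
  field_simp [Complex.exp_ne_zero]

/-! ### The positive Mellin kernel of `Λ₀` and the absence of real zeros -/

-- The kernel is `θ(t) - 1` for `t > 1`, `θ(t) - t^(-1/2)` for `0 < t < 1`, and `0` otherwise. The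
-- term `n = 0` gives `θ ≥ 1`, and the functional equation transfers this to `t < 1`.
open MeasureTheory HurwitzZeta Set in
theorem hurwitzEvenFEPair_zero_f_modif_eq_norm (t : ℝ) :
    (hurwitzEvenFEPair 0).f_modif t = (‖(hurwitzEvenFEPair 0).f_modif t‖ : ℂ) := by
  have hone : ∀ t : ℝ, 0 < t → 1 ≤ evenKernel 0 t := by
    intro t ht
    have h := hasSum_int_evenKernel 0 ht
    have h2 := h.summable.le_tsum 0 (fun n _ => (Real.exp_pos _).le)
    rw [h.tsum_eq] at h2
    simpa using h2
  have aux : ∀ (x : ℝ) (y : ℂ), y = (x : ℂ) → 0 ≤ x → y = (‖y‖ : ℂ) := by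
    rintro x _ rfl hx
    rw [Complex.norm_real, Real.norm_of_nonneg hx]
  rcases le_or_gt t 0 with h0 | h0
  · refine aux 0 _ ?_ le_rfl
    simp [WeakFEPair.f_modif, (by linarith : ¬ 1 < t), (by linarith : ¬ 0 < t)]
  rcases lt_trichotomy t 1 with h1 | rfl | h1
  · refine aux (evenKernel 0 t - 1 / t ^ (1 / 2 : ℝ)) _ ?_ ?_
    · simp [WeakFEPair.f_modif, h1.not_gt, h0, h1, hurwitzEvenFEPair, Real.rpow_neg h0.le]
    · rw [evenKernel_functional_equation, ← evenKernel_eq_cosKernel_of_zero, sub_nonneg]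
      exact le_mul_of_one_le_right (by positivity) (hone _ (by positivity))
  · refine aux 0 _ ?_ le_rfl
    simp [WeakFEPair.f_modif]
  · refine aux (evenKernel 0 t - 1) _ ?_ (sub_nonneg.2 (hone t h0))
    simp [WeakFEPair.f_modif, h1, h1.not_gt, hurwitzEvenFEPair]

namespace RiemannXi

open MeasureTheory HurwitzZeta

/-- The restriction of `Λ₀` to the real line, as the Mellin transform of a nonnegative kernel. -/
noncomputable def realCompleted (x : ℝ) : ℝ :=
  (∫ t in Set.Ioi (0 : ℝ), t ^ (x / 2 - 1) * ‖(hurwitzEvenFEPair 0).f_modif t‖) / 2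

theorem integrableOn_realCompleted (x : ℝ) :
    IntegrableOn (fun t : ℝ => t ^ (x / 2 - 1) * ‖(hurwitzEvenFEPair 0).f_modif t‖)
      (Set.Ioi 0) := by
  have h := ((hurwitzEvenFEPair 0).isStrongFEPair_toStrongFEPair.hasMellin
    ((x / 2 : ℝ) : ℂ)).1.norm
  refine IntegrableOn.congr_fun h (fun t ht => ?_) measurableSet_Ioi
  simp only [norm_smul]
  rw [Complex.norm_cpow_eq_rpow_re_of_pos ht]
  simp [WeakFEPair.toStrongFEPair]

theorem completedRiemannZeta₀_ofReal (x : ℝ) :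
    completedRiemannZeta₀ x = (realCompleted x : ℂ) := by
  rw [completedRiemannZeta₀, completedHurwitzZetaEven₀, WeakFEPair.Λ₀, mellin, realCompleted,
    Complex.ofReal_div, ← integral_complex_ofReal]
  congr 1
  refine setIntegral_congr_fun measurableSet_Ioi fun t ht => ?_
  have ht : 0 < t := ht
  rw [hurwitzEvenFEPair_zero_f_modif_eq_norm t, smul_eq_mul, Complex.ofReal_mul,
    Complex.ofReal_cpow ht.le, Complex.norm_real, norm_norm]
  push_cast
  rfl

theorem norm_completedRiemannZeta₀_le_realCompleted (s : ℂ) :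
    ‖completedRiemannZeta₀ s‖ ≤ realCompleted s.re := by
  rw [completedRiemannZeta₀, completedHurwitzZetaEven₀, WeakFEPair.Λ₀, mellin, realCompleted,
    norm_div, Complex.norm_ofNat]
  refine div_le_div_of_nonneg_right ?_ zero_le_two
  refine (norm_integral_le_integral_norm _).trans (le_of_eq ?_)
  refine setIntegral_congr_fun measurableSet_Ioi fun t ht => ?_
  simp only [norm_smul]
  rw [Complex.norm_cpow_eq_rpow_re_of_pos ht]
  simp

/-- Pointwise, `t^(x/2-1)` is dominated by the power with exponent from `a` if `t ≤ 1` and from `b`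
if `t ≥ 1`. -/
theorem realCompleted_le_add {a b x : ℝ} (ha : a ≤ x) (hb : x ≤ b) :
    realCompleted x ≤ realCompleted a + realCompleted b := by
  rw [realCompleted, realCompleted, realCompleted, ← add_div]
  refine div_le_div_of_nonneg_right ?_ zero_le_two
  rw [← integral_add (integrableOn_realCompleted a) (integrableOn_realCompleted b)]
  refine setIntegral_mono_on (integrableOn_realCompleted x)
    ((integrableOn_realCompleted a).add (integrableOn_realCompleted b)) measurableSet_Ioi
    fun t ht => ?_
  have ht : 0 < t := ht
  rw [← add_mul]
  refine mul_le_mul_of_nonneg_right ?_ (norm_nonneg _)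
  rcases le_total t 1 with h1 | h1
  · have := Real.rpow_le_rpow_of_exponent_ge ht h1 (by linarith : a / 2 - 1 ≤ x / 2 - 1)
    have := Real.rpow_nonneg ht.le (b / 2 - 1)
    linarith
  · have := Real.rpow_le_rpow_of_exponent_le h1 (by linarith : x / 2 - 1 ≤ b / 2 - 1)
    have := Real.rpow_nonneg ht.le (a / 2 - 1)
    linarith

theorem norm_completedRiemannZeta₀_le_add {a b : ℝ} {s : ℂ} (ha : a ≤ s.re) (hb : s.re ≤ b) :
    ‖completedRiemannZeta₀ s‖ ≤ ‖completedRiemannZeta₀ a‖ + ‖completedRiemannZeta₀ b‖ := by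
  refine (norm_completedRiemannZeta₀_le_realCompleted s).trans
    ((realCompleted_le_add ha hb).trans ?_)
  rw [completedRiemannZeta₀_ofReal, completedRiemannZeta₀_ofReal, Complex.norm_real,
    Complex.norm_real]
  exact add_le_add (le_abs_self _) (le_abs_self _)

theorem completedRiemannZeta₀_conj (s : ℂ) :
    completedRiemannZeta₀ (starRingEnd ℂ s) = starRingEnd ℂ (completedRiemannZeta₀ s) := by
  rw [completedRiemannZeta₀, completedRiemannZeta₀, completedHurwitzZetaEven₀,
    completedHurwitzZetaEven₀, WeakFEPair.Λ₀, mellin, mellin, map_div₀, ← integral_conj, map_ofNat]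
  congr 1
  have hs : starRingEnd ℂ s / 2 - 1 = starRingEnd ℂ (s / 2 - 1) := by simp [map_ofNat]
  refine setIntegral_congr_fun measurableSet_Ioi fun t ht => ?_
  have ht : 0 < t := ht
  rw [hurwitzEvenFEPair_zero_f_modif_eq_norm t, smul_eq_mul, smul_eq_mul, map_mul,
    Complex.conj_ofReal, hs, Complex.cpow_conj _ _ (by simp [Complex.arg_ofReal_of_nonneg ht.le,
      Real.pi_ne_zero.symm]), Complex.conj_ofReal]

theorem xi_conj (s : ℂ) : xi (starRingEnd ℂ s) = starRingEnd ℂ (xi s) := by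
  rw [xi, xi, completedRiemannZeta₀_conj]
  simp [map_ofNat]

theorem norm_completedRiemannZeta₀_one_lt : ‖completedRiemannZeta₀ 1‖ < 2 := by
  have h4 : (0 : ℝ) < 4 * Real.pi := by positivity
  have h : completedRiemannZeta₀ 1 =
      (((Real.eulerMascheroniConstant - Real.log (4 * Real.pi)) / 2 + 1 : ℝ) : ℂ) := by
    rw [completedRiemannZeta₀_one]
    push_cast [Complex.ofReal_log h4.le]
    rfl
  rw [h, Complex.norm_real, Real.norm_eq_abs, abs_lt]
  have h1 := Real.one_half_lt_eulerMascheroniConstant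
  have h2 := Real.eulerMascheroniConstant_lt_two_thirds
  have h3 : 0 ≤ Real.log (4 * Real.pi) := Real.log_nonneg (by linarith [Real.pi_gt_three])
  have h5 : Real.log (4 * Real.pi) ≤ Real.log (2 ^ 4) :=
    Real.log_le_log h4 (by linarith [Real.pi_lt_four])
  rw [Real.log_pow] at h5
  have := Real.log_two_lt_d9
  push_cast at h5
  constructor <;> linarith

/-- A zero would give `x(1-x)Λ₀(x) = 1`, but `x(1-x) ≤ 1/4` and `|Λ₀(x)| ≤ |Λ₀(0)| + |Λ₀(1)| < 4`.
-/
theorem xi_ofReal_ne_zero {x : ℝ} (h0 : 0 ≤ x) (h1 : x ≤ 1) : xi x ≠ 0 := by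
  intro h
  have hΛ : ‖completedRiemannZeta₀ x‖ < 4 := by
    have h2 := norm_completedRiemannZeta₀_le_add (a := 0) (b := 1) (s := x) (by simpa) (by simpa)
    have h3 := completedRiemannZeta₀_one_sub 1
    rw [sub_self] at h3
    rw [Complex.ofReal_zero, Complex.ofReal_one, h3] at h2
    linarith [norm_completedRiemannZeta₀_one_lt]
  have h2 : (x : ℂ) * (1 - x) * completedRiemannZeta₀ x = 1 := by
    rw [xi] at h
    linear_combination -2 * h
  have h3 := congrArg norm h2
  rw [norm_mul, norm_one, ← Complex.ofReal_one, ← Complex.ofReal_sub, ← Complex.ofReal_mul,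
    Complex.norm_real, Real.norm_of_nonneg (mul_nonneg h0 (sub_nonneg.2 h1))] at h3
  have := norm_nonneg (completedRiemannZeta₀ x)
  nlinarith [sq_nonneg (x - 1 / 2)]

theorem im_ne_zero_of_mem_nontrivialZeros {ρ : ℂ} (h : ρ ∈ nontrivialZeros) : ρ.im ≠ 0 := by
  intro him
  have h2 : ((ρ.re : ℝ) : ℂ) = ρ := Complex.ext (by simp) (by simp [him])
  refine xi_ofReal_ne_zero h.2.1.le h.2.2.le ?_
  rw [h2]
  exact (mem_nontrivialZeros_iff ρ).1 h

/-! ### Growth of `ξ` -/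

theorem exists_norm_completedRiemannZeta₀_le_factorial :
    ∃ C : ℝ, 0 < C ∧ ∀ n : ℕ, 0 < n →
      ‖completedRiemannZeta₀ ((4 * n : ℝ) : ℂ)‖ ≤ C * (2 * n).factorial := by
  have hsum : Summable fun m : ℕ => 1 / (m : ℝ) ^ 2 := Real.summable_one_div_nat_pow.2 one_lt_two
  have hS0 : 0 ≤ ∑' m : ℕ, 1 / (m : ℝ) ^ 2 := tsum_nonneg fun m => by positivity
  refine ⟨(∑' m : ℕ, 1 / (m : ℝ) ^ 2) + 2, by linarith, fun n hn => ?_⟩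
  set S := ∑' m : ℕ, 1 / (m : ℝ) ^ 2
  have hn1 : (1 : ℝ) ≤ n := by exact_mod_cast hn
  have hfac : (1 : ℝ) ≤ (2 * n).factorial := by exact_mod_cast (2 * n).factorial_pos
  have hne : ∀ k : ℕ, ((4 * n : ℝ) : ℂ) ≠ -(2 * k) := by
    intro k hk
    have h1 : (4 * n : ℝ) = -(2 * k) := by exact_mod_cast hk
    have : (0 : ℝ) ≤ k := k.cast_nonneg
    linarith
  have hζ : ‖riemannZeta ((4 * n : ℝ) : ℂ)‖ ≤ S := by
    have h1 := zeta_nat_eq_tsum_of_gt_one (k := 4 * n) (by omega)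
    have h2 : (((4 * n : ℕ) : ℂ)) = ((4 * n : ℝ) : ℂ) := by push_cast; rfl
    rw [← h2, h1]
    refine tsum_of_norm_bounded hsum.hasSum fun m => ?_
    rw [norm_div, norm_one, norm_pow, Complex.norm_natCast]
    -- The term `m = 0` is `1 / 0 = 0` by convention.
    rcases Nat.eq_zero_or_pos m with rfl | hm
    · rw [Nat.cast_zero, zero_pow (by omega), div_zero]
      positivity
    · have hm1 : (1 : ℝ) ≤ m := by exact_mod_cast hm
      exact one_div_le_one_div_of_le (by positivity) (pow_le_pow_right₀ hm1 (by omega))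
  have hπ : ‖(Real.pi : ℂ) ^ (-((4 * n : ℝ) : ℂ) / 2)‖ ≤ 1 := by
    rw [Complex.norm_cpow_eq_rpow_re_of_pos Real.pi_pos]
    refine Real.rpow_le_one_of_one_le_of_nonpos (by linarith [Real.pi_gt_three]) ?_
    simp only [Complex.div_ofNat_re, Complex.neg_re, Complex.ofReal_re]
    linarith
  have hΓ : ‖Complex.Gamma (((4 * n : ℝ) : ℂ) / 2)‖ ≤ (2 * n).factorial := by
    have h1 : ((4 * n : ℝ) : ℂ) / 2 = ((2 * n - 1 : ℕ) : ℂ) + 1 := by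
      rw [Nat.cast_sub (by omega)]
      push_cast
      ring
    rw [h1, Complex.Gamma_nat_eq_factorial, Complex.norm_natCast]
    exact_mod_cast Nat.factorial_le (by omega)
  have hΛ : ‖completedRiemannZeta ((4 * n : ℝ) : ℂ)‖ ≤ (2 * n).factorial * S := by
    rw [completed_eq hne, norm_mul, norm_mul]
    refine mul_le_mul ?_ hζ (norm_nonneg _) (by positivity)
    calc _ ≤ 1 * ((2 * n).factorial : ℝ) := mul_le_mul hπ hΓ (norm_nonneg _) zero_le_one
      _ = _ := one_mul _
  have heq : completedRiemannZeta₀ ((4 * n : ℝ) : ℂ) = completedRiemannZeta ((4 * n : ℝ) : ℂ) +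
      ((1 / (4 * n) + 1 / (1 - 4 * n) : ℝ) : ℂ) := by
    rw [completedRiemannZeta_eq]
    push_cast
    ring
  have hsmall : ‖((1 / (4 * n) + 1 / (1 - 4 * n) : ℝ) : ℂ)‖ ≤ 2 := by
    rw [Complex.norm_real]
    refine (norm_add_le _ _).trans ?_
    have h1 : ‖(1 / (4 * n) : ℝ)‖ ≤ 1 := by
      rw [Real.norm_of_nonneg (by positivity)]
      exact (div_le_one (by positivity)).2 (by linarith)
    have h2 : ‖(1 / (1 - 4 * n) : ℝ)‖ ≤ 1 := by
      rw [norm_div, norm_one, Real.norm_of_nonpos (by linarith)]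
      exact (div_le_one (by linarith)).2 (by linarith)
    linarith
  rw [heq]
  refine (norm_add_le _ _).trans ?_
  nlinarith

theorem exists_norm_xi_half_add_le :
    ∃ C : ℝ, 0 < C ∧ ∀ n : ℕ, 0 < n → ∀ z : ℂ, ‖z‖ = 2 * n →
      ‖xi (1 / 2 + z)‖ ≤ C * (2 * n : ℝ) ^ (2 * n + 2) := by
  obtain ⟨C, hC, hCn⟩ := exists_norm_completedRiemannZeta₀_le_factorial
  refine ⟨2 * C + 1, by linarith, fun n hn z hz => ?_⟩
  have hn1 : (1 : ℝ) ≤ n := by exact_mod_cast hn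
  have hre := Complex.abs_re_le_norm z
  rw [hz, abs_le] at hre
  -- The circle lies in the strip `1 - 4n ≤ Re ≤ 4n`, whose two real endpoints share one value of
  -- `Λ₀` by the functional equation.
  have hΛ : ‖completedRiemannZeta₀ (1 / 2 + z)‖ ≤ 2 * (C * (2 * n).factorial) := by
    have h1 := norm_completedRiemannZeta₀_le_add (a := 1 - 4 * n) (b := 4 * n) (s := 1 / 2 + z)
      (by simp; linarith) (by simp; linarith)
    rw [Complex.ofReal_sub, Complex.ofReal_one, completedRiemannZeta₀_one_sub] at h1
    linarith [hCn n hn]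
  have hfac : ((2 * n).factorial : ℝ) ≤ (2 * n : ℝ) ^ (2 * n) := by
    exact_mod_cast Nat.factorial_le_pow (2 * n)
  have hpow : (1 : ℝ) ≤ (2 * n : ℝ) ^ (2 * n) := one_le_pow₀ (by linarith)
  have hquad : ‖(1 / 2 + z) * (1 / 2 + z - 1)‖ ≤ 2 * (2 * n : ℝ) ^ 2 := by
    have h1 : (1 / 2 + z) * (1 / 2 + z - 1) = z ^ 2 - 1 / 4 := by ring
    rw [h1]
    refine (norm_sub_le _ _).trans ?_
    rw [norm_pow, hz]
    norm_num
    nlinarith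
  rw [xi, norm_div, Complex.norm_ofNat, div_le_iff₀ two_pos]
  refine (norm_add_le _ _).trans ?_
  rw [norm_mul, norm_one, pow_add]
  have h3 := mul_le_mul hquad hΛ (norm_nonneg _) (by positivity)
  have h4 : 2 * (2 * n : ℝ) ^ 2 * (2 * (C * (2 * n).factorial)) ≤
      2 * (2 * n : ℝ) ^ 2 * (2 * (C * (2 * n : ℝ) ^ (2 * n))) := by gcongr
  have h5 : (1 : ℝ) ≤ (2 * n : ℝ) ^ (2 * n) * (2 * n : ℝ) ^ 2 :=
    one_le_mul_of_one_le_of_one_le hpow (one_le_pow₀ (by linarith))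
  nlinarith

theorem tendsto_add_two_mul_log_add_div_sq (B : ℝ) :
    Tendsto (fun n : ℕ => ((2 * n + 2) * Real.log (2 * n) + B) / (n : ℝ) ^ 2) atTop (𝓝 0) := by
  have hinv : Tendsto (fun n : ℕ => ((n : ℝ))⁻¹) atTop (𝓝 0) := tendsto_inv_atTop_nhds_zero_nat
  have hlog : Tendsto (fun n : ℕ => Real.log (2 * n) / (2 * n)) atTop (𝓝 0) := by
    have h1 : Tendsto (fun n : ℕ => (2 * n : ℝ)) atTop atTop :=
      tendsto_natCast_atTop_atTop.const_mul_atTop two_pos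
    exact (Real.isLittleO_log_id_atTop.tendsto_div_nhds_zero).comp h1
  have h := ((hinv.const_mul 2).const_add 2).mul (hlog.const_mul 2) |>.add
    ((hinv.mul hinv).const_mul B)
  simp only [mul_zero, add_zero] at h
  refine h.congr' ?_
  filter_upwards [eventually_gt_atTop 0] with n hn
  have : (n : ℝ) ≠ 0 := Nat.cast_ne_zero.2 hn.ne'
  field_simp

end RiemannXi

/-! ### Infinite products with multiplicities -/

theorem Finset.one_add_sum_le_prod_one_add_pow {ι : Type*} (t : Finset ι) (x : ι → ℝ)
    (m : ι → ℕ) (hx : ∀ i, 0 ≤ x i) :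
    1 + ∑ i ∈ t, m i * x i ≤ ∏ i ∈ t, (1 + x i) ^ m i := by
  classical
  induction t using Finset.induction_on with
  | empty => simp
  | insert b t hb ih =>
    rw [Finset.sum_insert hb, Finset.prod_insert hb]
    have h1 : 1 + m b * x b ≤ (1 + x b) ^ m b :=
      one_add_mul_le_pow (by linarith [hx b]) _
    have h2 : 0 ≤ ∑ i ∈ t, m i * x i :=
      Finset.sum_nonneg fun i _ => mul_nonneg (Nat.cast_nonneg _) (hx i)
    have h3 : 0 ≤ m b * x b := mul_nonneg (Nat.cast_nonneg _) (hx b)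
    have h4 := mul_le_mul h1 ih (by linarith) (by linarith)
    nlinarith [mul_nonneg h3 h2]

/-- With `x = m|a|`, `|(1+a)^m - 1| ≤ e^x - 1 ≤ x e^x`, and the total sum bounds `x` in the exponent
uniformly. -/
theorem multipliable_one_add_pow_of_summable {ι : Type*} {a : ι → ℂ} {m : ι → ℕ}
    (h : Summable fun i => m i * ‖a i‖) : Multipliable fun i => (1 + a i) ^ m i := by
  have hnn : ∀ i, 0 ≤ m i * ‖a i‖ := fun i => by positivity
  have hb : ∀ i, ‖(1 + a i) ^ m i - 1‖ ≤
      m i * ‖a i‖ * Real.exp (∑' j, m j * ‖a j‖) := by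
    intro i
    have h1 := Finset.norm_prod_one_add_sub_one_le (Finset.range (m i)) (fun _ => a i)
    simp only [Finset.prod_const, Finset.sum_const, Finset.card_range, nsmul_eq_mul] at h1
    have h2 : Real.exp (m i * ‖a i‖) - 1 ≤ m i * ‖a i‖ * Real.exp (m i * ‖a i‖) := by
      have h3 := Real.add_one_le_exp (-(m i * ‖a i‖))
      have h4 := mul_le_mul_of_nonneg_right h3 (Real.exp_pos (m i * ‖a i‖)).le
      rw [← Real.exp_add, neg_add_cancel, Real.exp_zero] at h4
      linarith
    refine h1.trans (h2.trans ?_)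
    gcongr
    exact h.le_tsum i fun j _ => hnn j
  have hs : Summable fun i => ‖(1 + a i) ^ m i - 1‖ :=
    Summable.of_nonneg_of_le (fun _ => norm_nonneg _) hb (h.mul_right _)
  simpa using multipliable_one_add_of_summable hs

theorem Filter.tendsto_finset_subtype_atTop {α ι : Type*} {l : Filter ι} {U : Set α}
    [DecidablePred (· ∈ U)] {A : ι → Finset α} (hA : ∀ a ∈ U, ∀ᶠ i in l, a ∈ A i) :
    Tendsto (fun i => (A i).subtype (· ∈ U)) l atTop := by
  refine tendsto_atTop.2 fun S => ?_
  have : ∀ᶠ i in l, ∀ a ∈ S, (a : α) ∈ A i :=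
    (Filter.eventually_all_finset S).2 fun a _ => hA a a.2
  filter_upwards [this] with i hi a ha
  exact Finset.mem_subtype.2 (hi a ha)

/-! ### Symmetries of the zeros and the product over discs centred at `1/2` -/

namespace RiemannXi

theorem ne_zero_of_mem_nontrivialZeros {ρ : ℂ} (h : ρ ∈ nontrivialZeros) : ρ ≠ 0 := by
  rintro rfl
  simpa using h.2.1

theorem conj_mem_nontrivialZeros {ρ : ℂ} (h : ρ ∈ nontrivialZeros) :
    starRingEnd ℂ ρ ∈ nontrivialZeros := by
  rw [mem_nontrivialZeros_iff] at h ⊢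
  rw [xi_conj, h, map_zero]

theorem one_sub_mem_nontrivialZeros {ρ : ℂ} (h : ρ ∈ nontrivialZeros) :
    1 - ρ ∈ nontrivialZeros := by
  rw [mem_nontrivialZeros_iff] at h ⊢
  rw [xi_one_sub, h]

theorem xi_half_ne_zero : xi (1 / 2) ≠ 0 := by
  have := xi_ofReal_ne_zero (x := 1 / 2) (by norm_num) (by norm_num)
  push_cast at this
  exact this

theorem mult_one_sub (ρ : ℂ) : mult (1 - ρ) = mult ρ := by
  have h := analyticOrderAt_comp_of_deriv_ne_zero (f := xi) (g := fun z : ℂ => 1 - z) (z₀ := ρ)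
    (by fun_prop) (by simp)
  have h2 : xi ∘ (fun z : ℂ => 1 - z) = xi := funext xi_one_sub
  rw [h2] at h
  rw [mult, mult, analyticOrderNatAt, analyticOrderNatAt, h]

theorem mult_half_add (a : ℂ) :
    analyticOrderNatAt (fun z => xi (1 / 2 + z)) a = mult (1 / 2 + a) := by
  have h := analyticOrderAt_comp_of_deriv_ne_zero (f := xi) (g := fun z : ℂ => 1 / 2 + z)
    (z₀ := a) (by fun_prop) (by simp)
  rw [mult, analyticOrderNatAt, analyticOrderNatAt, ← h]
  rfl

/-- Conjugation is not holomorphic, so the factorization of `xi` at `ρ` is conjugated instead of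
composing orders. -/
theorem mult_conj (ρ : ℂ) : mult (starRingEnd ℂ ρ) = mult ρ := by
  have htop := differentiable_xi.analyticOrderAt_ne_top xi_half_ne_zero
  obtain ⟨g, hg, hgρ, hxi⟩ := differentiable_xi.exists_eq_pow_mul (htop ρ)
  rw [mult, (differentiable_xi.analyticAt _).analyticOrderNatAt_eq_iff (htop _)]
  refine ⟨starRingEnd ℂ ∘ g ∘ starRingEnd ℂ, Differentiable.analyticAt (fun z => ?_) _, ?_,
    .of_forall fun z => ?_⟩
  · exact differentiableAt_conj_conj_iff.2 (hg _)
  · simpa using hgρ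
  · have h1 := hxi (starRingEnd ℂ z)
    rw [xi_conj] at h1
    have h2 := congrArg (starRingEnd ℂ) h1
    simpa [mult] using h2

open Classical in
/-- The zeros within distance `n` of the centre `1 / 2` of symmetry. -/
noncomputable def zerosNear (n : ℕ) : Finset ℂ :=
  (zerosUpTo (n + 1)).filter fun ρ => ‖ρ - 1 / 2‖ ≤ n

theorem mem_zerosUpTo {T : ℝ} {ρ : ℂ} : ρ ∈ zerosUpTo T ↔ ρ ∈ nontrivialZeros ∧ ‖ρ‖ ≤ T := by
  simp [zerosUpTo]

/-- The radius `n + 1` in `zerosNear` only supplies finiteness: `|ρ| ≤ |ρ - 1/2| + 1/2`. -/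
theorem mem_zerosNear {n : ℕ} {ρ : ℂ} :
    ρ ∈ zerosNear n ↔ ρ ∈ nontrivialZeros ∧ ‖ρ - 1 / 2‖ ≤ n := by
  rw [zerosNear, Finset.mem_filter, mem_zerosUpTo]
  refine ⟨fun h => ⟨h.1.1, h.2⟩, fun h => ⟨⟨h.1, ?_⟩, h.2⟩⟩
  calc ‖ρ‖ = ‖(ρ - 1 / 2) + 1 / 2‖ := by rw [sub_add_cancel]
    _ ≤ ‖ρ - 1 / 2‖ + ‖(1 / 2 : ℂ)‖ := norm_add_le _ _
    _ ≤ n + 1 := add_le_add h.2 (by norm_num)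

theorem tendsto_prod_zerosNear_centered (z : ℂ) :
    Tendsto (fun n => ∏ ρ ∈ zerosNear n, (1 - z / (ρ - 1 / 2)) ^ mult ρ) atTop
      (𝓝 (xi (1 / 2 + z) / xi (1 / 2))) := by
  classical
  obtain ⟨C, hC, hbound⟩ := exists_norm_xi_half_add_le
  have hx : 0 < ‖xi (1 / 2)‖ := norm_pos_iff.2 xi_half_ne_zero
  -- `B ≤ exp B` absorbs the constant, and `B > 0` keeps `M n` positive even at `n = 0`, where `log
  -- 0 = 0`.
  set B := C / ‖xi (1 / 2)‖ with hB
  have hBpos : 0 < B := div_pos hC hx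
  have hlog : ∀ n : ℕ, 0 ≤ Real.log (2 * n) := fun n => by
    have := Real.log_natCast_nonneg (2 * n)
    rwa [Nat.cast_mul, Nat.cast_ofNat] at this
  have h := tendsto_prod_one_sub_div_of_even (f := fun z => xi (1 / 2 + z))
    (Z := fun n => (zerosNear n).image (· - 1 / 2))
    (M := fun n => (2 * n + 2) * Real.log (2 * n) + B)
    (differentiable_xi.comp (by fun_prop)) (fun z => ?_) (by simpa using xi_half_ne_zero)
    (fun n a => ?_) (fun n => ?_) (tendsto_add_two_mul_log_add_div_sq B) ?_ z
  · rw [add_zero] at h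
    refine h.congr fun n => ?_
    rw [Finset.prod_image (by simp)]
    refine Finset.prod_congr rfl fun ρ _ => ?_
    rw [mult_half_add, add_sub_cancel]
  · rw [← xi_one_sub]
    congr 1
    ring
  · rw [Finset.mem_image, ← mem_nontrivialZeros_iff]
    constructor
    · rintro ⟨ρ, hρ, rfl⟩
      rw [mem_zerosNear] at hρ
      rwa [add_sub_cancel]
    · intro ha
      exact ⟨1 / 2 + a, mem_zerosNear.2 (by rwa [add_sub_cancel_left]), add_sub_cancel_left _ _⟩
  · have := hlog n
    positivity
  · filter_upwards [eventually_gt_atTop 0] with n hn z hz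
    have hn' : (0 : ℝ) < n := Nat.cast_pos.2 hn
    refine (hbound n hn z hz).trans ?_
    rw [add_zero, Real.exp_add]
    have h1 : Real.exp ((2 * n + 2) * Real.log (2 * n)) = (2 * n : ℝ) ^ (2 * n + 2) := by
      rw [mul_comm, ← Real.rpow_def_of_pos (by positivity), ← Real.rpow_natCast]
      push_cast
      rfl
    have h2 : B ≤ Real.exp B := by linarith [Real.add_one_le_exp B]
    have h3 : C = ‖xi (1 / 2)‖ * B := by
      rw [hB, mul_div_cancel₀ _ hx.ne']
    rw [h1]
    calc C * (2 * n : ℝ) ^ (2 * n + 2) = ‖xi (1 / 2)‖ * ((2 * n : ℝ) ^ (2 * n + 2) * B) := by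
          rw [h3]; ring
      _ ≤ _ := by gcongr

/-- Dividing the centred product at `s - 1/2` by the one at `-1/2` turns each factor into `(ρ -
s)/ρ`. -/
theorem tendsto_prod_zerosNear (s : ℂ) :
    Tendsto (fun n => ∏ ρ ∈ zerosNear n, (1 - s / ρ) ^ mult ρ) atTop (𝓝 (2 * xi s)) := by
  have h1 := tendsto_prod_zerosNear_centered (s - 1 / 2)
  have h2 := tendsto_prod_zerosNear_centered (0 - 1 / 2)
  rw [add_sub_cancel] at h1 h2
  have hx := xi_half_ne_zero
  have h3 := h1.div h2 (div_ne_zero (by rw [xi_zero]; norm_num) hx)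
  have h4 : xi s / xi (1 / 2) / (xi 0 / xi (1 / 2)) = 2 * xi s := by
    rw [xi_zero]
    field_simp
  rw [h4] at h3
  refine h3.congr fun n => ?_
  rw [Pi.div_apply, ← Finset.prod_div_distrib]
  refine Finset.prod_congr rfl fun ρ hρ => ?_
  have hρ' := (mem_zerosNear.1 hρ).1
  have hρ0 := ne_zero_of_mem_nontrivialZeros hρ'
  have hρ2 : ρ - 1 / 2 ≠ 0 := by
    intro h
    rw [sub_eq_zero] at h
    exact hx (h ▸ (mem_nontrivialZeros_iff ρ).1 hρ')
  rw [← div_pow]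
  congr 1
  have e1 : 1 - (s - 1 / 2) / (ρ - 1 / 2) = (ρ - s) / (ρ - 1 / 2) := by
    rw [eq_div_iff hρ2, sub_mul, div_mul_cancel₀ _ hρ2]
    ring
  have e2 : 1 - (0 - 1 / 2) / (ρ - 1 / 2) = ρ / (ρ - 1 / 2) := by
    rw [eq_div_iff hρ2, sub_mul, div_mul_cancel₀ _ hρ2]
    ring
  rw [e1, e2, div_div_div_cancel_right₀ hρ2, sub_div, div_self hρ0]

/-! ### Conjugate pairs and unconditional convergence -/

/-- The zeros in the upper half-plane. -/
def upperZeros : Set ℂ := {ρ | ρ ∈ nontrivialZeros ∧ 0 < ρ.im}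

/-- The product of the factors of `ρ` and of its conjugate. -/
noncomputable def conjFactor (ρ s : ℂ) : ℂ := (1 - s / ρ) * (1 - s / starRingEnd ℂ ρ)

theorem conjFactor_eq {ρ : ℂ} (hρ : ρ ≠ 0) (s : ℂ) :
    conjFactor ρ s = 1 + (s ^ 2 - 2 * s * ρ.re) / (‖ρ‖ ^ 2 : ℝ) := by
  have hc : starRingEnd ℂ ρ ≠ 0 := by simpa using hρ
  have h1 : ((‖ρ‖ ^ 2 : ℝ) : ℂ) = ρ * starRingEnd ℂ ρ := by
    rw [Complex.mul_conj, Complex.normSq_eq_norm_sq]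
  have h2 : (2 : ℂ) * ρ.re = ρ + starRingEnd ℂ ρ := by
    rw [Complex.add_conj]
    push_cast
    rfl
  rw [conjFactor, h1, mul_assoc, mul_left_comm, h2]
  field_simp
  ring

-- As no zero is real, exactly one member of each conjugate pair lies in the upper half-plane.
open Classical in
theorem prod_eq_prod_conjFactor {A : Finset ℂ} (hA : ∀ ρ ∈ A, ρ ∈ nontrivialZeros)
    (hconj : ∀ ρ ∈ A, starRingEnd ℂ ρ ∈ A) (s : ℂ) :
    ∏ ρ ∈ A, (1 - s / ρ) ^ mult ρ =
      ∏ ρ ∈ A.subtype (· ∈ upperZeros), conjFactor ρ s ^ mult ρ := by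
  rw [Finset.prod_subtype_eq_prod_filter (f := fun ρ : ℂ => conjFactor ρ s ^ mult ρ),
    ← Finset.prod_filter_mul_prod_filter_not A (· ∈ upperZeros)]
  have h : ∏ ρ ∈ A with ρ ∉ upperZeros, (1 - s / ρ) ^ mult ρ =
      ∏ ρ ∈ A with ρ ∈ upperZeros, (1 - s / starRingEnd ℂ ρ) ^ mult ρ := by
    refine Finset.prod_nbij' (starRingEnd ℂ) (starRingEnd ℂ) ?_ ?_ (by simp) (by simp) ?_
    · intro ρ hρ
      rw [Finset.mem_filter] at hρ ⊢
      have hz := hA ρ hρ.1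
      refine ⟨hconj ρ hρ.1, conj_mem_nontrivialZeros hz, ?_⟩
      have h0 : ¬ 0 < ρ.im := fun h => hρ.2 ⟨hz, h⟩
      rw [Complex.conj_im, neg_pos]
      exact lt_of_le_of_ne (not_lt.1 h0) (im_ne_zero_of_mem_nontrivialZeros hz)
    · intro ρ hρ
      rw [Finset.mem_filter] at hρ ⊢
      refine ⟨hconj ρ hρ.1, fun h => ?_⟩
      have h1 := h.2
      have h2 := hρ.2.2
      rw [Complex.conj_im] at h1
      linarith
    · intro ρ _
      rw [Complex.conj_conj, mult_conj]
  rw [h, ← Finset.prod_mul_distrib]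
  refine Finset.prod_congr rfl fun ρ _ => ?_
  rw [conjFactor, mul_pow]

theorem conj_mem_zerosNear {n : ℕ} {ρ : ℂ} (h : ρ ∈ zerosNear n) :
    starRingEnd ℂ ρ ∈ zerosNear n := by
  rw [mem_zerosNear] at h ⊢
  refine ⟨conj_mem_nontrivialZeros h.1, ?_⟩
  rw [← Complex.norm_conj]
  simpa [map_ofNat] using h.2

theorem eventually_mem_zerosNear {ρ : ℂ} (h : ρ ∈ nontrivialZeros) :
    ∀ᶠ n in atTop, ρ ∈ zerosNear n := by
  filter_upwards [tendsto_natCast_atTop_atTop.eventually_ge_atTop ‖ρ - 1 / 2‖] with n hn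
  exact mem_zerosNear.2 ⟨h, hn⟩

/-- At `s = 3` the paired factor is `1 + (9 - 6 Re ρ)/|ρ|²`, and `Re ρ < 1` makes the numerator
exceed `3`. The convergent products thus bound the partial sums, with no count of zeros. -/
theorem summable_mult_div_norm_sq :
    Summable fun ρ : upperZeros => (mult ρ : ℝ) * (1 / ‖(ρ : ℂ)‖ ^ 2) := by
  classical
  refine summable_of_sum_le (c := ‖2 * xi 3‖) (fun ρ => by positivity) fun u => ?_
  have hlim := (tendsto_prod_zerosNear 3).norm
  have hmem := tendsto_finset_subtype_atTop (U := upperZeros) (A := zerosNear) (l := atTop)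
    fun ρ hρ => eventually_mem_zerosNear hρ.1
  refine ge_of_tendsto hlim ?_
  filter_upwards [hmem.eventually_ge_atTop u] with n hn
  rw [prod_eq_prod_conjFactor (fun ρ hρ => (mem_zerosNear.1 hρ).1)
    (fun ρ hρ => conj_mem_zerosNear hρ), norm_prod]
  have h1 := Finset.one_add_sum_le_prod_one_add_pow
    ((zerosNear n).subtype (· ∈ upperZeros)) (fun ρ => 1 / ‖(ρ : ℂ)‖ ^ 2) (fun ρ => mult ρ)
    (fun ρ => by positivity)
  have h2 := Finset.sum_le_sum_of_subset_of_nonneg hn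
    (f := fun ρ : upperZeros => (mult ρ : ℝ) * (1 / ‖(ρ : ℂ)‖ ^ 2))
    (fun ρ _ _ => by positivity)
  have h3 : ∏ ρ ∈ (zerosNear n).subtype (· ∈ upperZeros), (1 + 1 / ‖(ρ : ℂ)‖ ^ 2) ^ mult ρ ≤
      ∏ ρ ∈ (zerosNear n).subtype (· ∈ upperZeros), ‖conjFactor ρ 3 ^ mult ρ‖ := by
    refine Finset.prod_le_prod (fun ρ _ => by positivity) fun ρ _ => ?_
    rw [norm_pow]
    refine pow_le_pow_left₀ (by positivity) ?_ _
    have hρ0 := ne_zero_of_mem_nontrivialZeros ρ.2.1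
    have hre := ρ.2.1.2.2
    have heq : conjFactor ρ 3 = ((1 + (9 - 6 * (ρ : ℂ).re) / ‖(ρ : ℂ)‖ ^ 2 : ℝ) : ℂ) := by
      rw [conjFactor_eq hρ0]
      push_cast
      ring
    rw [heq, Complex.norm_real]
    refine le_trans ?_ (Real.le_norm_self _)
    gcongr
    linarith
  linarith

theorem summable_mult_mul_norm {S : Set ℂ} (hS : S ⊆ upperZeros) (s : ℂ) :
    Summable fun ρ : S =>
      (mult ρ : ℝ) * ‖(s ^ 2 - 2 * s * (ρ : ℂ).re) / ((‖(ρ : ℂ)‖ ^ 2 : ℝ) : ℂ)‖ := by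
  have h := (summable_mult_div_norm_sq.comp_injective (Set.inclusion_injective hS)).mul_right
    (‖s‖ ^ 2 + 2 * ‖s‖)
  refine Summable.of_nonneg_of_le (fun ρ => by positivity) (fun ρ => ?_) h
  have hre := (hS ρ.2).1.2
  simp only [Function.comp]
  rw [norm_div, Complex.norm_real, Real.norm_of_nonneg (by positivity), mul_assoc (mult ρ : ℝ),
    one_div_mul_eq_div]
  gcongr
  refine (norm_sub_le _ _).trans ?_
  rw [norm_pow, norm_mul, norm_mul, Complex.norm_real, Complex.norm_ofNat,
    Real.norm_of_nonneg hre.1.le]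
  have := norm_nonneg s
  nlinarith [hre.2]

theorem multipliable_conjFactor {S : Set ℂ} (hS : S ⊆ upperZeros) (s : ℂ) :
    Multipliable fun ρ : S => conjFactor ρ s ^ mult ρ := by
  refine (multipliable_one_add_pow_of_summable (summable_mult_mul_norm hS s)).congr fun ρ => ?_
  rw [conjFactor_eq (ne_zero_of_mem_nontrivialZeros (hS ρ.2).1)]

theorem hasProd_conjFactor (s : ℂ) :
    HasProd (fun ρ : upperZeros => conjFactor ρ s ^ mult ρ) (2 * xi s) := by
  classical
  have h := (multipliable_conjFactor subset_rfl s).hasProd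
  have h1 := h.comp (tendsto_finset_subtype_atTop (A := zerosNear) (l := atTop)
    fun ρ hρ => eventually_mem_zerosNear hρ.1)
  have h2 := (tendsto_prod_zerosNear s).congr fun n =>
    prod_eq_prod_conjFactor (fun ρ hρ => (mem_zerosNear.1 hρ).1)
      (fun ρ hρ => conj_mem_zerosNear hρ) s
  rwa [tendsto_nhds_unique h1 h2] at h

/-- Discs about `0` are also stable under conjugation and exhaust the zeros, so the unconditional
paired product has the same limit along them. -/
theorem tendsto_prod_zerosUpTo (s : ℂ) :
    Tendsto (fun T => ∏ ρ ∈ zerosUpTo T, (1 - s / ρ) ^ mult ρ) atTop (𝓝 (2 * xi s)) := by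
  classical
  refine ((hasProd_conjFactor s).comp (tendsto_finset_subtype_atTop (A := zerosUpTo)
    (l := atTop) fun ρ hρ => ?_)).congr fun T => (prod_eq_prod_conjFactor
      (fun ρ hρ => (mem_zerosUpTo.1 hρ).1) (fun ρ hρ => ?_) s).symm
  · filter_upwards [eventually_ge_atTop ‖ρ‖] with T hT
    exact mem_zerosUpTo.2 ⟨hρ.1, hT⟩
  · rw [mem_zerosUpTo] at hρ ⊢
    exact ⟨conj_mem_nontrivialZeros hρ.1, by rw [Complex.norm_conj]; exact hρ.2⟩

/-! ### Closed forms of the factors and regrouping -/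

theorem one_sub_div_mul_one_sub_div {ρ : ℂ} (h0 : ρ ≠ 0) (h1 : 1 - ρ ≠ 0) (s : ℂ) :
    (1 - s / ρ) * (1 - s / (1 - ρ)) = 1 + (s ^ 2 - s) / (ρ * (1 - ρ)) := by
  field_simp
  ring

theorem onFactor_eq {ρ : ℂ} (h : ρ ∈ onLine) (s : ℂ) :
    (1 - s / ρ) * (1 - s / (1 - ρ)) = onFactor ρ s := by
  have h0 := ne_zero_of_mem_nontrivialZeros h.1
  have h1 := ne_zero_of_mem_nontrivialZeros (one_sub_mem_nontrivialZeros h.1)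
  rw [one_sub_div_mul_one_sub_div h0 h1, onFactor, beta]
  congr 2
  apply Complex.ext <;> simp [pow_two, h.2.1] <;> ring

theorem offFactor_eq {ρ : ℂ} (h : ρ ∈ offLine) (s : ℂ) :
    (1 - s / ρ) * (1 - s / (1 - ρ)) *
      ((1 - s / starRingEnd ℂ ρ) * (1 - s / (1 - starRingEnd ℂ ρ))) = offFactor ρ s := by
  have hc := conj_mem_nontrivialZeros h.1
  have h0 := ne_zero_of_mem_nontrivialZeros h.1
  have h1 := ne_zero_of_mem_nontrivialZeros (one_sub_mem_nontrivialZeros h.1)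
  have h2 := ne_zero_of_mem_nontrivialZeros hc
  have h3 := ne_zero_of_mem_nontrivialZeros (one_sub_mem_nontrivialZeros hc)
  -- With `w = ρ(1 - ρ)` and `u = s² - s` the product is `(1 + u/w)(1 + u/conj w)`, so only `w +
  -- conj w` and `w · conj w` are needed.
  have e1 : ρ * (1 - ρ) + starRingEnd ℂ ρ * (1 - starRingEnd ℂ ρ) =
      1 / 2 - 2 * delta ρ ^ 2 + 2 * beta ρ ^ 2 := by
    apply Complex.ext <;> simp [pow_two, delta, beta] <;> ring
  have e2 : ρ * (1 - ρ) * (starRingEnd ℂ ρ * (1 - starRingEnd ℂ ρ)) =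
      (1 / 4 + delta ρ ^ 2 + beta ρ ^ 2) ^ 2 - delta ρ ^ 2 := by
    apply Complex.ext <;> simp [pow_two, delta, beta] <;> ring
  rw [one_sub_div_mul_one_sub_div h0 h1, one_sub_div_mul_one_sub_div h2 h3, offFactor, ← e1, ← e2]
  field_simp
  ring

/-- The zeros to the left of the critical line and in the upper half-plane. -/
def leftOffLine : Set ℂ := {ρ | ρ ∈ nontrivialZeros ∧ ρ.re < 1 / 2 ∧ 0 < ρ.im}

/-- Reflection in the critical line. -/
def reflectEquiv : offLine ≃ leftOffLine where
  toFun ρ := ⟨1 - starRingEnd ℂ ρ,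
    one_sub_mem_nontrivialZeros (conj_mem_nontrivialZeros ρ.2.1), by
      have := ρ.2.2.1
      simp only [Complex.sub_re, Complex.one_re, Complex.conj_re]
      linarith, by simpa using ρ.2.2.2⟩
  invFun ρ := ⟨1 - starRingEnd ℂ ρ,
    one_sub_mem_nontrivialZeros (conj_mem_nontrivialZeros ρ.2.1), by
      have := ρ.2.2.1
      simp only [Complex.sub_re, Complex.one_re, Complex.conj_re]
      linarith, by simpa using ρ.2.2.2⟩
  left_inv ρ := by simp
  right_inv ρ := by simp

/-- On the critical line `conj ρ = 1 - ρ`, so the two pairings coincide. -/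
theorem conjFactor_eq_onFactor {ρ : ℂ} (h : ρ ∈ onLine) (s : ℂ) :
    conjFactor ρ s = onFactor ρ s := by
  rw [← onFactor_eq h, conjFactor]
  congr 3
  apply Complex.ext
  · simp [h.2.1]
    norm_num
  · simp

theorem conjFactor_mul_conjFactor_reflect {ρ : ℂ} (h : ρ ∈ offLine) (s : ℂ) :
    conjFactor ρ s * conjFactor (1 - starRingEnd ℂ ρ) s = offFactor ρ s := by
  rw [← offFactor_eq h, conjFactor, conjFactor, map_sub, map_one, Complex.conj_conj]
  ring

theorem upperZeros_eq : upperZeros = onLine ∪ (offLine ∪ leftOffLine) := by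
  ext ρ
  constructor
  · rintro ⟨h, him⟩
    rcases lt_trichotomy ρ.re (1 / 2) with hre | hre | hre
    · exact .inr (.inr ⟨h, hre, him⟩)
    · exact .inl ⟨h, hre, him⟩
    · exact .inr (.inl ⟨h, hre, him⟩)
  · rintro (h | h | h) <;> exact ⟨h.1, h.2.2⟩

theorem multipliable_onFactor (s : ℂ) :
    Multipliable fun ρ : onLine => onFactor ρ s ^ mult ρ :=
  (multipliable_conjFactor (S := onLine) (fun _ h => ⟨h.1, h.2.2⟩) s).congr fun ρ => by
    rw [conjFactor_eq_onFactor ρ.2]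

theorem multipliable_leftOffLine (s : ℂ) :
    Multipliable fun ρ : leftOffLine => conjFactor ρ s ^ mult ρ :=
  multipliable_conjFactor (fun _ h => ⟨h.1, h.2.2⟩) s

/-- The conjugate pairs of `ρ` and `1 - conj ρ` make up one quadruple, with a common multiplicity.
-/
theorem hasProd_offFactor (s : ℂ) :
    HasProd (fun ρ : offLine => offFactor ρ s ^ mult ρ)
      ((∏' ρ : offLine, conjFactor ρ s ^ mult ρ) *
        ∏' ρ : leftOffLine, conjFactor ρ s ^ mult ρ) := by
  have h1 := (multipliable_conjFactor (S := offLine) (fun _ h => ⟨h.1, h.2.2⟩) s).hasProd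
  have h2 := reflectEquiv.hasProd_iff.2 (multipliable_leftOffLine s).hasProd
  refine (h1.mul h2).congr_fun fun ρ => ?_
  have h3 : ((reflectEquiv ρ : leftOffLine) : ℂ) = 1 - starRingEnd ℂ ρ := rfl
  rw [Function.comp, h3, mult_one_sub, mult_conj, ← mul_pow,
    conjFactor_mul_conjFactor_reflect ρ.2]

theorem two_mul_xi_eq (s : ℂ) :
    2 * xi s = (∏' ρ : onLine, onFactor ρ s ^ mult ρ) *
      ∏' ρ : offLine, offFactor ρ s ^ mult ρ := by
  have h1 := (multipliable_onFactor s).hasProd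
  have h2 := (multipliable_conjFactor (S := offLine) (fun _ h => ⟨h.1, h.2.2⟩) s).hasProd
  have h3 := (multipliable_leftOffLine s).hasProd
  have d1 : Disjoint offLine leftOffLine :=
    Set.disjoint_left.2 fun ρ h h' => h.2.1.not_gt h'.2.1
  have d2 : Disjoint onLine (offLine ∪ leftOffLine) := by
    refine Set.disjoint_left.2 fun ρ h => ?_
    rintro (h' | h')
    · exact h'.2.1.ne' h.2.1
    · exact h'.2.1.ne h.2.1
  have h1' : HasProd ((fun ρ : ℂ => conjFactor ρ s ^ mult ρ) ∘ ((↑) : onLine → ℂ))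
      (∏' ρ : onLine, onFactor ρ s ^ mult ρ) :=
    h1.congr_fun fun ρ => by rw [Function.comp, conjFactor_eq_onFactor ρ.2]
  have h4 := HasProd.mul_disjoint (f := fun ρ : ℂ => conjFactor ρ s ^ mult ρ) d2 h1'
    (HasProd.mul_disjoint d1 h2 h3)
  have h5 := hasProd_conjFactor s
  rw [upperZeros_eq] at h5
  rw [(hasProd_offFactor s).tprod_eq]
  exact h5.unique h4

end RiemannXi

/-- Products over zeros count each zero with its multiplicity.  The five conjuncts: the Hadamard
product over all zeros, ordered by modulus, converges to `ξ(s)`; a pair `ρ, 1 - ρ` on the line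
gives the on-line factor; a quadruple off the line gives the off-line factor; the two regrouped
products converge; and together they give `ξ(s)`. -/
theorem theorem3p1 (s : ℂ) :
    Tendsto (fun T : ℝ => 1 / 2 * ∏ ρ ∈ RiemannXi.zerosUpTo T, (1 - s / ρ) ^ RiemannXi.mult ρ)
        atTop (𝓝 (RiemannXi.xi s)) ∧
      (∀ ρ ∈ RiemannXi.onLine, (1 - s / ρ) * (1 - s / (1 - ρ)) = RiemannXi.onFactor ρ s) ∧
      (∀ ρ ∈ RiemannXi.offLine,
        (1 - s / ρ) * (1 - s / (1 - ρ)) *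
            ((1 - s / (starRingEnd ℂ) ρ) * (1 - s / (1 - (starRingEnd ℂ) ρ))) =
          RiemannXi.offFactor ρ s) ∧
      (Multipliable (fun ρ : RiemannXi.onLine =>
          RiemannXi.onFactor ρ s ^ RiemannXi.mult ρ) ∧
        Multipliable (fun ρ : RiemannXi.offLine =>
          RiemannXi.offFactor ρ s ^ RiemannXi.mult ρ)) ∧
      RiemannXi.xi s =
        1 / 2 *
          (∏' ρ : RiemannXi.onLine, RiemannXi.onFactor ρ s ^ RiemannXi.mult ρ) *
          (∏' ρ : RiemannXi.offLine, RiemannXi.offFactor ρ s ^ RiemannXi.mult ρ) := by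
  refine ⟨?_, fun ρ h => RiemannXi.onFactor_eq h s, fun ρ h => RiemannXi.offFactor_eq h s,
    ⟨RiemannXi.multipliable_onFactor s, (RiemannXi.hasProd_offFactor s).multipliable⟩, ?_⟩
  · have h := (RiemannXi.tendsto_prod_zerosUpTo s).const_mul (1 / 2)
    rwa [← mul_assoc, one_div_mul_cancel two_ne_zero, one_mul] at h
  · rw [mul_assoc, ← RiemannXi.two_mul_xi_eq s, ← mul_assoc, one_div_mul_cancel two_ne_zero,
      one_mul]
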